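/- **Setup.** Manifolds are Hausdorff, second countable and without boundary. Let $G$ be a connected Lie group and $W$ a contractible smooth manifold. Let $\ell\colon G\to \mathrm{Homeo}(G\times W)$ be the homomorphism given by left multiplication on the first factor and the trivial action on the second. Let $\pi\subset \mathrm{Homeo}(G\times W)$ be a discrete group acting freely and properly on $G\times W$ (that is, freely and properly discontinuously). Suppose that 1. $\ell(G)$ is normalized by $\pi$ in $\mathrm{Homeo}(G\times W)$; 2. $\Gamma:=\pi\cap \ell(G)$ is normal in $\pi$ and $\ell^{-1}(\Gamma)$ is discrete in $G$; 3. the induced action of the discrete group $Q:=\pi/\Gamma$ on $W$ (the one for which the projection $G\times W\to W$ is $\pi$-equivariant, $\pi$ acting on $W$ through $Q$) is proper; 4. every element of $\pi$ acts smoothly on $G\times W$. Put $M:=(G\times W)/\pi$ and $B:=W/Q$, and let $p\colon M\to B$ be the map induced by the projection $G\times W\to W$; it is called a *smooth injective Seifert fibering* modeled on $G\times W\to W$. Its *typical fiber* is $G/\Gamma$, the quotient of $G$ by the action of $\ell^{-1}(\Gamma)$ by left multiplication. The spaces $M$ and $G/\Gamma$ carry the smooth structures for which the quotient maps $G\times W\to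 M$ and $G\to G/\Gamma$ are local diffeomorphisms. **Proposition.** Let $p\colon M\to B$ be a smooth injective Seifert fibering with typical fiber $G/\Gamma$. Then every $b\in B$ has an open neighbourhood $V_b$ such that the open submanifold $p^{-1}(V_b)\subset M$ admits a regular covering of finite degree by $G/\Gamma\times\mathbb{R}^{\dim W}$: there is a covering map $\psi\colon G/\Gamma\times\mathbb{R}^{\dim W}\to p^{-1}(V_b)$ which is a local diffeomorphism, all of whose fibers have the same finite positive cardinality, and whose deck transformations act transitively on each fiber. -/

import Mathlib

open scoped Manifold ContDiff

noncomputable section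

/-! ### Smooth structure on the quotient by a free properly discontinuous action

The charts of `MulAction.orbitRel.Quotient D X` (provided by Mathlib) are the charts of `X` composed
with local inverses of the quotient map.  If `D` acts smoothly, they form a smooth atlas. -/

theorem isManifold_orbitQuotient {𝕜 : Type*} [NontriviallyNormedField 𝕜]
    {E : Type*} [NormedAddCommGroup E] [NormedSpace 𝕜 E] {H : Type*} [TopologicalSpace H]
    (I : ModelWithCorners 𝕜 E H) (k : WithTop ℕ∞)
    (D : Type*) [Group D] (X : Type*) [TopologicalSpace X] [ChartedSpace H X] [IsManifold I k X]
    [MulAction D X] [ProperlyDiscontinuousSMul D X] [ContinuousConstSMul D X] [IsCancelSMul D X]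
    [T2Space X] [LocallyCompactSpace X]
    (hD : ∀ d : D, ContMDiff I I k fun x : X => d • x) :
    IsManifold I k (MulAction.orbitRel.Quotient D X) := by
  apply isManifold_of_contDiffOn
  have hq : IsLocalHomeomorph (Quotient.mk (MulAction.orbitRel D X)) :=
    (isQuotientCoveringMap_quotientMk_of_properlyDiscontinuousSMul
      (G := D) (E := X)).isCoveringMap.isLocalHomeomorph
  have key : ∀ x₁ x₂ : X, ContMDiffOn I I k
      (((hq.localInverseAt x₁).trans (chartAt H x₁)).symm.trans
        ((hq.localInverseAt x₂).trans (chartAt H x₂)))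
      (((hq.localInverseAt x₁).trans (chartAt H x₁)).symm.trans
        ((hq.localInverseAt x₂).trans (chartAt H x₂))).source := by
    intro x₁ x₂ u hu
    set L₁ := hq.localInverseAt x₁
    set L₂ := hq.localInverseAt x₂
    set c₁ := chartAt H x₁
    set c₂ := chartAt H x₂
    have hL₁ : ⇑L₁.symm = Quotient.mk (MulAction.orbitRel D X) := hq.localInverseAt_symm x₁
    have hL₂ : ⇑L₂.symm = Quotient.mk (MulAction.orbitRel D X) := hq.localInverseAt_symm x₂
    simp only [OpenPartialHomeomorph.trans_source, OpenPartialHomeomorph.symm_source,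
      OpenPartialHomeomorph.trans_symm_eq_symm_trans_symm,
      Set.mem_inter_iff, Set.mem_preimage, OpenPartialHomeomorph.coe_trans, Function.comp_apply]
      at hu
    obtain ⟨⟨hu₁, hu₂⟩, hu₃, hu₄⟩ := hu
    set x := c₁.symm u
    -- `L₂ (q x)` and `x` lie in one orbit
    have hx : Quotient.mk (MulAction.orbitRel D X) (L₂ (L₁.symm x))
        = Quotient.mk (MulAction.orbitRel D X) x := by
      rw [← hL₂, L₂.left_inv hu₃, hL₁, hL₂]
    obtain ⟨d, hd⟩ := (MulAction.orbitRel_apply.1 (Quotient.exact hx) :)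
    simp only at hd
    have hsm : ContMDiffAt I I k (fun v => c₂ (d • c₁.symm v)) u := by
      have h1 : ContMDiffAt I I k c₁.symm u :=
        (contMDiffOn_chart_symm (I := I) (n := k) (x := x₁)).contMDiffAt
          (c₁.open_target.mem_nhds hu₁)
      have h2 : ContMDiffAt I I k (fun y : X => d • y) (c₁.symm u) := (hD d).contMDiffAt
      have h3 : ContMDiffAt I I k c₂ (d • c₁.symm u) :=
        (contMDiffOn_chart (I := I) (n := k) (x := x₂)).contMDiffAt
          (c₂.open_source.mem_nhds (by rw [hd]; exact hu₄))
      exact ContMDiffAt.comp (g := c₂) u h3 (ContMDiffAt.comp (g := fun y : X => d • y) u h2 h1)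
    refine (hsm.congr_of_eventuallyEq ?_).contMDiffWithinAt
    have hc₁ : ContinuousAt c₁.symm u := c₁.symm.continuousAt hu₁
    have e1 : ∀ᶠ v in nhds u, d • c₁.symm v ∈ L₂.target := by
      refine ((continuous_const_smul d).continuousAt.comp hc₁).eventually
        (L₂.open_target.mem_nhds ?_)
      change d • c₁.symm u ∈ _
      rw [hd]
      exact L₂.map_source hu₃
    filter_upwards [e1] with v hv
    simp only [OpenPartialHomeomorph.coe_trans, OpenPartialHomeomorph.trans_symm_eq_symm_trans_symm,
      Function.comp_apply]
    congr 1
    have : L₁.symm (c₁.symm v) = L₂.symm (d • c₁.symm v) := by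
      rw [hL₁, hL₂]
      exact (Quotient.sound (MulAction.orbitRel_apply.2 ⟨d, rfl⟩) :
        Quotient.mk (MulAction.orbitRel D X) (d • c₁.symm v) = _).symm
    rw [this, L₂.right_inv hv]
  rintro e e' ⟨q₁, rfl⟩ ⟨q₂, rfl⟩
  rw [← contMDiffOn_iff_contDiffOn]
  refine I.contMDiff.comp_contMDiffOn ((key _ _).comp (I.contMDiffOn_symm.mono (by simp)) ?_)
  intro z hz
  exact hz.1

/-! ### Regular coverings -/

/-- A *regular covering of finite degree*: a covering map all of whose fibers have the same finite
positive number of points, and whose deck transformations act transitively on each fiber. -/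
structure IsRegularCoveringOfFiniteDegree {E X : Type*} [TopologicalSpace E] [TopologicalSpace X]
    (f : E → X) : Prop where
  isCoveringMap : IsCoveringMap f
  finite_degree : ∃ d : ℕ, 0 < d ∧ ∀ x : X, Nat.card (f ⁻¹' {x}) = d
  regular : ∀ e e' : E, f e = f e' → ∃ φ : E ≃ₜ E, (∀ z, f (φ z) = f z) ∧ φ e = e'

/-! ### Injective Seifert fiberings -/

namespace Seifert

/-- The group of homeomorphisms of a space acts on it by evaluation. -/
instance homeoAction (X : Type*) [TopologicalSpace X] : MulAction (X ≃ₜ X) X where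
  smul f x := f x
  one_smul _ := rfl
  mul_smul _ _ _ := rfl

instance (X : Type*) [TopologicalSpace X] : ContinuousConstSMul (X ≃ₜ X) X :=
  ⟨fun f => f.continuous⟩

/-- The homomorphism `ℓ : G → Homeo (G × W)` given by left multiplication on the first factor and
the trivial action on the second. -/
def ell (G W : Type*) [Group G] [TopologicalSpace G] [IsTopologicalGroup G] [TopologicalSpace W] :
    G →* (G × W ≃ₜ G × W) where
  toFun a := (Homeomorph.mulLeft a).prodCongr (Homeomorph.refl W)
  map_one' := by ext x <;> simp
  map_mul' a b := by ext x <;> simp [mul_assoc]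

/-- A discrete group `π` of homeomorphisms of `G × W` which acts freely and properly, normalizes
`ℓ(G)`, and whose intersection `Γ = π ∩ ℓ(G)` is normal in `π` with `ℓ⁻¹(Γ)` discrete in `G`.
(For discrete groups, proper actions are the properly discontinuous ones.) -/
structure Setup (G W : Type*) [Group G] [TopologicalSpace G] [IsTopologicalGroup G]
    [TopologicalSpace W] where
  /-- the group `π` -/
  π : Subgroup (G × W ≃ₜ G × W)
  free : ∀ f ∈ π, ∀ x, f x = x → f = 1
  proper : ProperlyDiscontinuousSMul π (G × W)
  normalizes : π ≤ Subgroup.normalizer ((ell G W).range : Set (G × W ≃ₜ G × W))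
  normal : ((π ⊓ (ell G W).range).subgroupOf π).Normal
  discrete : DiscreteTopology ((π ⊓ (ell G W).range).comap (ell G W))

namespace Setup

variable {G W : Type*} [Group G] [TopologicalSpace G] [IsTopologicalGroup G] [TopologicalSpace W]
  (S : Setup G W)

/-- `Γ = π ∩ ℓ(G)`, as a subgroup of `π`. -/
abbrev Γ : Subgroup S.π := (S.π ⊓ (ell G W).range).subgroupOf S.π

instance : S.Γ.Normal := S.normal

/-- `ℓ⁻¹(Γ)`, the group `Γ` regarded as a subgroup of `G`. -/
abbrev ΓG : Subgroup G := (S.π ⊓ (ell G W).range).comap (ell G W)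

instance : DiscreteTopology S.ΓG := S.discrete

instance : ProperlyDiscontinuousSMul S.π (G × W) := S.proper

instance : ContinuousConstSMul S.π (G × W) := ⟨fun f => f.1.continuous⟩

instance : IsCancelSMul S.π (G × W) :=
  isCancelSMul_iff_eq_one_of_smul_eq.mpr fun f x h => Subtype.ext (S.free f f.2 x h)

/-- The `W`-component of an element of `π` does not depend on the `G`-coordinate. -/
theorem snd_apply (f : S.π) (g : G) (w : W) : (f.1 (g, w)).2 = (f.1 (1, w)).2 := by
  obtain ⟨a, ha⟩ := (S.normalizes f.2 (ell G W g)).1 ⟨g, rfl⟩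
  have h : ell G W a * f.1 = f.1 * ell G W g := by rw [ha]; group
  have h' := congrArg Prod.snd (DFunLike.congr_fun h ((1 : G), w))
  simpa [ell] using h'.symm

/-- The action of `π` on `W` for which the projection `G × W → W` is equivariant. -/
instance actionπ : MulAction S.π W where
  smul f w := (f.1 (1, w)).2
  one_smul _ := rfl
  mul_smul f f' w := by
    change (f.1 (f'.1 (1, w))).2 = (f.1 (1, (f'.1 (1, w)).2)).2
    rw [← S.snd_apply f (f'.1 (1, w)).1]

theorem smul_snd (f : S.π) (x : G × W) : f • x.2 = (f • x).2 := (S.snd_apply f x.1 x.2).symm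

theorem Γ_le_ker : S.Γ ≤ (MulAction.toPermHom S.π W).ker := by
  intro f hf
  obtain ⟨a, ha⟩ := (Subgroup.mem_subgroupOf.1 hf).2
  refine Equiv.ext fun w => ?_
  change (f.1 (1, w)).2 = w
  rw [← ha]
  rfl

/-- `Q = π / Γ`. -/
abbrev Q : Type _ := S.π ⧸ S.Γ

/-- The induced action of `Q = π / Γ` on `W`. -/
instance actionQ : MulAction S.Q W :=
  MulAction.compHom W (QuotientGroup.lift S.Γ (MulAction.toPermHom S.π W) S.Γ_le_ker)

theorem mk_smul_snd (f : S.π) (x : G × W) : (f : S.Q) • x.2 = (f • x).2 := S.smul_snd f x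

instance [T2Space G] [LocallyCompactSpace G] : ProperlyDiscontinuousSMul S.ΓG G :=
  S.ΓG.properlyDiscontinuousSMul_of_tendsto_cofinite
    (S.ΓG.tendsto_coe_cofinite_of_discrete (isDiscrete_iff_discreteTopology.mpr S.discrete))

end Setup

end Seifert

open Seifert

/-- An injective Seifert fibering modeled on the product bundle `G × W → W`: a group `π` as in
`Seifert.Setup` for which the induced action of the discrete group `Q = π / Γ` on `W` is proper. -/
structure InjectiveSeifertFibering (G W : Type*) [Group G] [TopologicalSpace G]
    [IsTopologicalGroup G] [TopologicalSpace W] where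
  toSetup : Setup G W
  proper_Q : ProperlyDiscontinuousSMul toSetup.Q W

namespace InjectiveSeifertFibering

variable {G W : Type*} [Group G] [TopologicalSpace G] [IsTopologicalGroup G] [TopologicalSpace W]
  (S : InjectiveSeifertFibering G W)

/-- The injective Seifert fiber space `M = (G × W) / π`. -/
abbrev TotalSpace : Type _ := MulAction.orbitRel.Quotient S.toSetup.π (G × W)

/-- The base `B = W / Q`. -/
abbrev Base : Type _ := MulAction.orbitRel.Quotient S.toSetup.Q W

/-- The typical fiber `G / Γ`: the quotient of `G` by the action of `Γ` by left multiplication. -/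
abbrev TypicalFiber : Type _ := MulAction.orbitRel.Quotient S.toSetup.ΓG G

/-- The Seifert fibering `p : M → B`, induced by the projection `G × W → W`. -/
def p : C(S.TotalSpace, S.Base) where
  toFun := Quotient.map' (s₁ := MulAction.orbitRel S.toSetup.π (G × W))
    (s₂ := MulAction.orbitRel S.toSetup.Q W) Prod.snd (by
      rintro x y ⟨f, rfl⟩
      exact ⟨(f : S.toSetup.Q), S.toSetup.mk_smul_snd f y⟩)
  continuous_toFun := continuous_snd.quotient_map' _

section Smooth

variable {m n : ℕ} [ChartedSpace (EuclideanSpace ℝ (Fin m)) G]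
  [ChartedSpace (EuclideanSpace ℝ (Fin n)) W]

/-- The smooth atlas of `M = (G × W) / π`: the charts are charts of `G × W` composed with local
inverses of the quotient map. -/
instance chartedSpaceTotalSpace [T2Space G] [T2Space W] :
    ChartedSpace (ModelProd (EuclideanSpace ℝ (Fin m)) (EuclideanSpace ℝ (Fin n))) S.TotalSpace :=
  haveI : LocallyCompactSpace G := ChartedSpace.locallyCompactSpace (EuclideanSpace ℝ (Fin m)) G
  haveI : LocallyCompactSpace W := ChartedSpace.locallyCompactSpace (EuclideanSpace ℝ (Fin n)) W
  MulAction.instChartedSpaceQuotient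

/-- The smooth atlas of `G / Γ`: the charts are charts of `G` composed with local inverses of the
quotient map. -/
instance chartedSpaceTypicalFiber [T2Space G] :
    ChartedSpace (EuclideanSpace ℝ (Fin m)) S.TypicalFiber :=
  haveI : LocallyCompactSpace G := ChartedSpace.locallyCompactSpace (EuclideanSpace ℝ (Fin m)) G
  MulAction.instChartedSpaceQuotient

/-- The fibering is *smooth* if `π` acts smoothly on `G × W`. -/
def IsSmooth (m n : ℕ) [ChartedSpace (EuclideanSpace ℝ (Fin m)) G]
    [ChartedSpace (EuclideanSpace ℝ (Fin n)) W] : Prop :=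
  ∀ f ∈ S.toSetup.π, ContMDiff ((𝓡 m).prod (𝓡 n)) ((𝓡 m).prod (𝓡 n)) ∞ f

theorem isManifold_totalSpace [T2Space G] [T2Space W] [IsManifold (𝓡 m) ∞ G]
    [IsManifold (𝓡 n) ∞ W] (hS : S.IsSmooth m n) :
    IsManifold ((𝓡 m).prod (𝓡 n)) ∞ S.TotalSpace :=
  haveI : LocallyCompactSpace G := ChartedSpace.locallyCompactSpace (EuclideanSpace ℝ (Fin m)) G
  haveI : LocallyCompactSpace W := ChartedSpace.locallyCompactSpace (EuclideanSpace ℝ (Fin n)) W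
  isManifold_orbitQuotient _ _ S.toSetup.π (G × W) fun f => hS f f.2

instance isManifold_typicalFiber [T2Space G] [LieGroup (𝓡 m) ∞ G] :
    IsManifold (𝓡 m) ∞ S.TypicalFiber :=
  haveI : LocallyCompactSpace G := ChartedSpace.locallyCompactSpace (EuclideanSpace ℝ (Fin m)) G
  haveI : IsManifold (𝓡 m) ∞ G := ContMDiffMul.toIsManifold (I := 𝓡 m) (n := ∞) (G := G)
  isManifold_orbitQuotient _ _ S.toSetup.ΓG G fun d =>
    contMDiff_mul_left (I := 𝓡 m) (n := ∞) (a := (d : G))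

end Smooth

end InjectiveSeifertFibering

end

/-!
Let `w` be a point of `W` and `F` its isotropy group in `Q`.  As `Q` acts properly, `F` is finite,
and `w` has a neighbourhood `N` which meets no translate `q • N` with `q ∉ F`.  Inside `N` there is
an `F`-invariant open neighbourhood `U` of `w` diffeomorphic to `ℝⁿ`
(`exists_partialDiffeomorph_invariant`).

To find it, take a chart `c` at `w` and consider the map `x ↦ (c (q • x) - c w)_q` into
`⨁_{q ∈ F} ℝⁿ`, which is equivariant for the permutation action of `F` by isometries.  Its
derivative at `w` is injective, with `F`-invariant image `L`, and the composite with the orthogonal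
projection to `L` is a local diffeomorphism at `w` whose norm is `F`-invariant
(`exists_isLocalDiffeomorphAt_norm_smul_eq`).  The preimage of a small ball in `L` is `U`.

Since `Γ` is normal in `π`, the action of `π` descends to `G / Γ × W`, which maps onto `M` with the
orbits of `π` as fibers.  Because `π` acts freely on `G × W`, two elements of `π` agree at a point
of `G / Γ × W` exactly if they agree modulo `Γ` (`smul_eq_smul_iff`).  Let `V` be the image of `U`
in `B`.  An element of `π` which moves a point of `G / Γ × U` into `G / Γ × U` lies over `F`, so the
fibers of `G / Γ × U → p⁻¹(V)` are the simply transitive orbits of `F`, and this map is a regular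
covering of degree `|F|` (`IsLocalHomeomorph.isRegularCoveringOfFiniteDegree`).  It is a local
diffeomorphism because the quotient maps `G → G / Γ` and `G × W → M` are.
-/

/-! ### Local diffeomorphisms -/

section LocalDiffeomorph

variable {𝕜 : Type*} [NontriviallyNormedField 𝕜]
  {E : Type*} [NormedAddCommGroup E] [NormedSpace 𝕜 E]
  {E' : Type*} [NormedAddCommGroup E'] [NormedSpace 𝕜 E']
  {F : Type*} [NormedAddCommGroup F] [NormedSpace 𝕜 F]
  {F' : Type*} [NormedAddCommGroup F'] [NormedSpace 𝕜 F']
  {H : Type*} [TopologicalSpace H] {H' : Type*} [TopologicalSpace H']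
  {K : Type*} [TopologicalSpace K] {K' : Type*} [TopologicalSpace K']
  {I : ModelWithCorners 𝕜 E H} {I' : ModelWithCorners 𝕜 E' H'}
  {J : ModelWithCorners 𝕜 F K} {J' : ModelWithCorners 𝕜 F' K'}
  {M : Type*} [TopologicalSpace M] [ChartedSpace H M]
  {M' : Type*} [TopologicalSpace M'] [ChartedSpace H' M']
  {N : Type*} [TopologicalSpace N] [ChartedSpace K N]
  {N' : Type*} [TopologicalSpace N'] [ChartedSpace K' N']
  {k : WithTop ℕ∞}

namespace IsLocalDiffeomorphAt

theorem congr_of_eventuallyEq {f g : M → N} {x : M} (hf : IsLocalDiffeomorphAt I J k f x)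
    (h : g =ᶠ[nhds x] f) : IsLocalDiffeomorphAt I J k g x := by
  obtain ⟨Φ, hx, hΦ⟩ := hf
  obtain ⟨s, hs, hso, hxs⟩ := eventually_nhds_iff.1 h
  let Ψ := Φ.toOpenPartialHomeomorph.restrOpen s hso
  refine ⟨⟨Ψ.toPartialEquiv, Ψ.open_source, Ψ.open_target, Φ.contMDiffOn_toFun.mono ?_,
    Φ.contMDiffOn_invFun.mono ?_⟩, ⟨hx, hxs⟩, fun y hy => ?_⟩
  · exact fun y hy => hy.1
  · exact fun y hy => hy.1
  · exact (hs y hy.2).trans (hΦ hy.1)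

/-- The right factor of a local diffeomorphism can be cancelled. -/
theorem of_comp {f : N → N'} {s : M → N} {x : M} (hs : IsLocalDiffeomorphAt I J k s x)
    (hfs : IsLocalDiffeomorphAt I J' k (f ∘ s) x) : IsLocalDiffeomorphAt J J' k f (s x) := by
  have h : s (hs.localInverse (s x)) = s x := hs.localInverse_right_inv hs.localInverse_mem_source
  have hx : hs.localInverse (s x) = x := hs.localInverse_left_inv hs.localInverse_mem_target
  have := hs.localInverse_isLocalDiffeomorphAt.comp _ _ (g := f ∘ s) (by rwa [hx])
  refine this.congr_of_eventuallyEq ?_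
  filter_upwards [hs.localInverse_eventuallyEq_right] with y hy
  exact (congrArg f hy).symm

/-- The left factor of a local diffeomorphism can be cancelled. -/
theorem of_comp_left {f : M → N} {g : N → N'} {x : M} (hg : IsLocalDiffeomorphAt J J' k g (f x))
    (hgf : IsLocalDiffeomorphAt I J' k (g ∘ f) x) (hf : ContinuousAt f x) :
    IsLocalDiffeomorphAt I J k f x := by
  refine (hgf.comp _ _ (g := hg.localInverse)
    hg.localInverse_isLocalDiffeomorphAt).congr_of_eventuallyEq ?_
  filter_upwards [hf.eventually hg.localInverse_eventuallyEq_left] with y hy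
  exact hy.symm

theorem prodMap {f : M → N} {g : M' → N'} {x : M} {y : M'}
    (hf : IsLocalDiffeomorphAt I J k f x) (hg : IsLocalDiffeomorphAt I' J' k g y) :
    IsLocalDiffeomorphAt (I.prod I') (J.prod J') k (Prod.map f g) (x, y) := by
  obtain ⟨Φ, hx, hΦ⟩ := hf
  obtain ⟨Ψ, hy, hΨ⟩ := hg
  exact ⟨⟨Φ.toPartialEquiv.prod Ψ.toPartialEquiv, Φ.open_source.prod Ψ.open_source,
    Φ.open_target.prod Ψ.open_target, Φ.contMDiffOn_toFun.prodMap Ψ.contMDiffOn_toFun,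
    Φ.contMDiffOn_invFun.prodMap Ψ.contMDiffOn_invFun⟩, ⟨hx, hy⟩,
    fun z hz => Prod.ext (hΦ hz.1) (hΨ hz.2)⟩

end IsLocalDiffeomorphAt

theorem isLocalDiffeomorphAt_chartAt [IsManifold I k M] (x : M) :
    IsLocalDiffeomorphAt I I k (chartAt H x) x :=
  ⟨⟨(chartAt H x).toPartialEquiv, (chartAt H x).open_source, (chartAt H x).open_target,
    contMDiffOn_chart, contMDiffOn_chart_symm⟩, mem_chart_source H x, fun _ _ => rfl⟩

/-- A map which is the identity in the preferred charts is a local diffeomorphism. -/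
theorem isLocalDiffeomorphAt_of_chartAt_comp_eventuallyEq [IsManifold I k M]
    {N : Type*} [TopologicalSpace N] [ChartedSpace H N] [IsManifold I k N] {f : M → N} {x : M}
    (hf : ContinuousAt f x) (h : chartAt H (f x) ∘ f =ᶠ[nhds x] chartAt H x) :
    IsLocalDiffeomorphAt I I k f x :=
  (isLocalDiffeomorphAt_chartAt (f x)).of_comp_left
    ((isLocalDiffeomorphAt_chartAt x).congr_of_eventuallyEq h) hf

theorem TopologicalSpace.Opens.isLocalDiffeomorph_subtypeVal [IsManifold I k M]
    (U : TopologicalSpace.Opens M) :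
    IsLocalDiffeomorph I I k (Subtype.val : U → M) := fun x =>
  isLocalDiffeomorphAt_of_chartAt_comp_eventuallyEq continuousAt_subtype_val
    (Filter.Eventually.of_forall fun y => by
      have : Nonempty U := ⟨x⟩
      rw [TopologicalSpace.Opens.chartAt_eq, OpenPartialHomeomorph.subtypeRestr_coe]; rfl)

/-- At the representative that defines the preferred chart, the projection is the identity in the
preferred charts; the action moves any other point to that representative by a diffeomorphism. -/
theorem isLocalDiffeomorph_orbitQuotient_mk
    {D : Type*} [Group D] {X : Type*} [TopologicalSpace X] [ChartedSpace H X] [IsManifold I k X]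
    [MulAction D X] [ProperlyDiscontinuousSMul D X] [ContinuousConstSMul D X] [IsCancelSMul D X]
    [T2Space X] [LocallyCompactSpace X]
    (hD : ∀ d : D, ContMDiff I I k fun x : X => d • x) :
    IsLocalDiffeomorph I I k
      (Quotient.mk (MulAction.orbitRel D X) : X → MulAction.orbitRel.Quotient D X) := by
  have := isManifold_orbitQuotient I k D X hD
  set q : X → MulAction.orbitRel.Quotient D X := Quotient.mk (MulAction.orbitRel D X)
  have hq : IsLocalHomeomorph q :=
    (isQuotientCoveringMap_quotientMk_of_properlyDiscontinuousSMul
      (G := D) (E := X)).isCoveringMap.isLocalHomeomorph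
  have hsurj : Function.Surjective q := Quotient.mk_surjective
  -- the representative that defines the preferred chart at a point of the quotient
  let r := hsurj.hasRightInverse.choose
  have hr : Function.RightInverse r q := hsurj.hasRightInverse.choose_spec
  have key : ∀ y, IsLocalDiffeomorphAt I I k q (r y) := fun y => by
    refine isLocalDiffeomorphAt_of_chartAt_comp_eventuallyEq hq.continuous.continuousAt ?_
    rw [hr y]
    filter_upwards [(hq.localInverseAt (r y)).open_target.mem_nhds
      hq.self_mem_localInverseAt_target] with z hz
    change chartAt H (r y) (hq.localInverseAt (r y) (q z)) = _
    have hz' := (hq.localInverseAt (r y)).right_inv hz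
    rw [hq.localInverseAt_symm] at hz'
    rw [hz']
  intro x
  obtain ⟨d, hd⟩ := (MulAction.orbitRel_apply.1 (Quotient.exact (hr (q x))) :)
  let δ : X ≃ₘ^k⟮I, I⟯ X :=
    { toEquiv := MulAction.toPerm d
      contMDiff_toFun := hD d
      contMDiff_invFun := hD d⁻¹ }
  have hδ : δ x = r (q x) := hd
  refine ((δ.isLocalDiffeomorph x).comp _ _ (g := q) (hδ ▸ key (q x))).congr_of_eventuallyEq
    (Filter.Eventually.of_forall fun z => ?_)
  exact (Quotient.sound (MulAction.orbitRel_apply.2 ⟨d, rfl⟩) : q (d • z) = q z).symm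

end LocalDiffeomorph

/-! ### Invariant balls around a fixed point of a finite group -/

/-- The inverse function theorem in the smooth category. -/
theorem ContDiffOn.isLocalDiffeomorphAt {E F : Type*} [NormedAddCommGroup E] [NormedSpace ℝ E]
    [CompleteSpace E] [NormedAddCommGroup F] [NormedSpace ℝ F] {f : E → F} {s : Set E} {a : E}
    (hf : ContDiffOn ℝ ∞ f s) (hs : s ∈ nhds a) (ha : (fderiv ℝ f a).IsInvertible) :
    IsLocalDiffeomorphAt 𝓘(ℝ, E) 𝓘(ℝ, F) ∞ f a := by
  obtain ⟨T, hT⟩ := ha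
  have hfa : ContDiffAt ℝ ∞ f a := hf.contDiffAt hs
  have hder : HasFDerivAt f (T : E →L[ℝ] F) a := by
    rw [hT]
    exact (hfa.differentiableAt (by simp)).hasFDerivAt
  -- the derivative stays invertible near `a`, so the inverse is smooth on a neighbourhood
  have hnear : ∀ᶠ x in nhds a, (fderiv ℝ f x).IsInvertible ∧ s ∈ nhds x := by
    refine Filter.Eventually.and ?_ (eventually_mem_nhds_iff.2 hs)
    refine (hfa.continuousAt_fderiv (by simp)).eventually
      (ContinuousLinearEquiv.isOpen.mem_nhds (?_ : _ ∈ Set.range _))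
    exact ⟨T, hT⟩
  obtain ⟨u, hu, huo, hau⟩ := eventually_nhds_iff.1 hnear
  let e := (hfa.toOpenPartialHomeomorph f hder (by simp)).restrOpen u huo
  refine ⟨⟨e.toPartialEquiv, e.open_source, e.open_target, ?_, ?_⟩,
    ⟨hfa.mem_toOpenPartialHomeomorph_source hder (by simp), hau⟩, fun _ _ => rfl⟩
  · exact contMDiffOn_iff_contDiffOn.2 fun x hx =>
      (hf.contDiffAt (hu x hx.2).2).contDiffWithinAt
  · refine contMDiffOn_iff_contDiffOn.2 fun y hy => ContDiffAt.contDiffWithinAt ?_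
    have hx : e.symm y ∈ u := (e.map_target hy).2
    obtain ⟨T', hT'⟩ := (hu _ hx).1
    have hfx : ContDiffAt ℝ ∞ f (e.symm y) := hf.contDiffAt (hu _ hx).2
    refine e.contDiffAt_symm (f₀' := T') hy ?_ hfx
    rw [hT']
    exact (hfx.differentiableAt (by simp)).hasFDerivAt

/-- If isometries of an inner product space `V` preserve the image of an injective linear map `T`,
the orthogonal projection of `V` to that image commutes with them, so its norm is invariant. -/
theorem exists_continuousLinearMap_norm_eq {n : ℕ} {V ι : Type*} [NormedAddCommGroup V]
    [InnerProductSpace ℝ V] {T : EuclideanSpace ℝ (Fin n) →L[ℝ] V} (hT : Function.Injective T)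
    (σ : ι → V ≃ₗᵢ[ℝ] V)
    (hσ : ∀ q v, σ q (T v) ∈ LinearMap.range (T : EuclideanSpace ℝ (Fin n) →ₗ[ℝ] V)) :
    ∃ P : V →L[ℝ] EuclideanSpace ℝ (Fin n), (∀ q v, ‖P (σ q v)‖ = ‖P v‖) ∧
      (P ∘L T).IsInvertible := by
  let L : Submodule ℝ V := LinearMap.range (T : EuclideanSpace ℝ (Fin n) →ₗ[ℝ] V)
  have hL : Module.finrank ℝ L = n := by
    rw [LinearMap.finrank_range_of_inj hT, finrank_euclideanSpace_fin]
  have hσL : ∀ q, L.map ((σ q).toLinearEquiv : V →ₗ[ℝ] V) = L := fun q => by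
    refine Submodule.eq_of_le_of_finrank_eq ?_ (LinearEquiv.finrank_map_eq _ _)
    rintro _ ⟨_, ⟨v, rfl⟩, rfl⟩
    exact hσ q v
  have hproj : ∀ q v,
      ‖L.orthogonalProjectionOnto (σ q v)‖ = ‖L.orthogonalProjectionOnto v‖ := fun q v => by
    have h := Submodule.starProjection_map_apply (σ q) L (σ q v)
    simp only [hσL q, LinearIsometryEquiv.symm_apply_apply] at h
    have h' := congrArg norm h
    rwa [LinearIsometryEquiv.norm_map] at h'
  let κ : L ≃ₗᵢ[ℝ] EuclideanSpace ℝ (Fin n) :=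
    ((stdOrthonormalBasis ℝ L).reindex (finCongr hL)).repr
  let P : V →L[ℝ] EuclideanSpace ℝ (Fin n) :=
    ((κ : L ≃L[ℝ] EuclideanSpace ℝ (Fin n)) : L →L[ℝ] EuclideanSpace ℝ (Fin n)) ∘L
      L.orthogonalProjectionOnto
  have hinj : Function.Injective (P ∘L T) := fun v v' h => by
    have hv : ∀ u, L.orthogonalProjectionOnto (T u) = ⟨T u, u, rfl⟩ := fun u =>
      Submodule.orthogonalProjectionOnto_mem_subspace_eq_self (⟨T u, u, rfl⟩ : L)
    have h' : L.orthogonalProjectionOnto (T v) = L.orthogonalProjectionOnto (T v') :=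
      κ.injective h
    rw [hv, hv] at h'
    exact hT (congrArg Subtype.val h')
  refine ⟨P, fun q v => ?_, (LinearEquiv.ofInjectiveEndo (P ∘L T).toLinearMap
    hinj).toContinuousLinearEquiv, by ext1 v; rfl⟩
  simpa [P] using hproj q v

section Slice

variable {n : ℕ} {W : Type*} [TopologicalSpace W] [ChartedSpace (EuclideanSpace ℝ (Fin n)) W]
  [IsManifold (𝓡 n) ∞ W] {F : Type*} [Group F] [Finite F] [MulAction F W]

/-- Coordinates at a fixed point of a smooth action of a finite group in which the norm is
invariant.  A chart `c` gives the equivariant map `x ↦ (c (q • x) - c w)_q` to a space of functions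
on `F`, on which `F` acts by isometries; the image of its derivative at `w` is an invariant
subspace, and the coordinates are obtained by projecting orthogonally to that subspace. -/
theorem exists_isLocalDiffeomorphAt_norm_smul_eq
    (hF : ∀ q : F, ContMDiff (𝓡 n) (𝓡 n) ∞ fun x : W => q • x) {w : W} (hw : ∀ q : F, q • w = w) :
    ∃ h : W → EuclideanSpace ℝ (Fin n), IsLocalDiffeomorphAt (𝓡 n) (𝓡 n) ∞ h w ∧ h w = 0 ∧
      ∀ᶠ x in nhds w, ∀ q : F, ‖h (q • x)‖ = ‖h x‖ := by
  have := Fintype.ofFinite F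
  let E := EuclideanSpace ℝ (Fin n)
  let V := PiLp 2 fun _ : F => E
  -- given explicitly because instance search for it is slow
  have : ContinuousSMul ℝ V := IsBoundedSMul.continuousSMul
  let c := chartAt E w
  let a : E := c w
  have hwc : w ∈ c.source := mem_chart_source E w
  have hca : c.symm a = w := c.left_inv hwc
  -- the points whose whole orbit lies in the domain of the chart
  let D : Set W := ⋂ q : F, (fun x => q • x) ⁻¹' c.source
  have hDo : IsOpen D := isOpen_iInter_of_finite fun q => c.open_source.preimage (hF q).continuous
  have hwD : w ∈ D := Set.mem_iInter.2 fun q => by simpa [hw q] using hwc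
  let s : Set E := c.target ∩ c.symm ⁻¹' D
  have hso : IsOpen s := c.isOpen_inter_preimage_symm hDo
  have has : a ∈ s := ⟨c.map_source hwc, by simpa [hca] using hwD⟩
  have hτ : ∀ q : F, ContDiffOn ℝ ∞ (fun y => c (q • c.symm y)) s := fun q => by
    rw [← contMDiffOn_iff_contDiffOn]
    refine (contMDiffOn_chart (I := 𝓡 n) (n := ∞) (x := w)).comp
      (((hF q).contMDiffOn (s := Set.univ)).comp
        ((contMDiffOn_chart_symm (I := 𝓡 n) (n := ∞) (x := w)).mono fun y hy => hy.1)
        fun _ _ => trivial) fun y hy => ?_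
    exact Set.mem_iInter.1 hy.2 q
  let g : E → V := fun y => WithLp.toLp 2 fun q => c (q • c.symm y) - a
  have hg : ContDiffOn ℝ ∞ g s := contDiffOn_piLp' _ fun q => (hτ q).sub contDiffOn_const
  have hsa : s ∈ nhds a := hso.mem_nhds has
  let T : E →L[ℝ] V := fderiv ℝ g a
  have hT : HasFDerivAt g T a :=
    ((hg.contDiffAt hsa).differentiableAt (by simp)).hasFDerivAt
  have hTone : ∀ v, T v 1 = v := fun v => by
    have h1 : HasFDerivAt (fun y => g y 1) ((PiLp.proj 2 (fun _ : F => E) 1 : V →L[ℝ] E) ∘L T) a :=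
      (PiLp.proj 2 (fun _ : F => E) 1 : V →L[ℝ] E).hasFDerivAt.comp a hT
    have h2 : HasFDerivAt (fun y => g y 1) (ContinuousLinearMap.id ℝ E) a := by
      refine ((hasFDerivAt_id a).sub_const a).congr_of_eventuallyEq ?_
      filter_upwards [hsa] with y hy
      simp [g, c.right_inv hy.1]
    exact DFunLike.congr_fun (h1.unique h2) v
  have hTinj : Function.Injective T := fun v v' h => by rw [← hTone v, h, hTone]
  -- the permutation of coordinates that makes `g` equivariant
  let σ : F → V ≃ₗᵢ[ℝ] V := fun q =>
    LinearIsometryEquiv.piLpCongrLeft 2 ℝ E (Equiv.mulRight q).symm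
  have hgσ : ∀ q, ∀ y ∈ s, g (c (q • c.symm y)) = σ q (g y) := fun q y hy => by
    ext1 q'
    have : c.symm (c (q • c.symm y)) = q • c.symm y := c.left_inv (Set.mem_iInter.1 hy.2 q)
    change c (q' • c.symm (c (q • c.symm y))) - a = c ((q' * q) • c.symm y) - a
    rw [this, smul_smul]
  have hσT : ∀ q v, σ q (T v) ∈ LinearMap.range (T : E →ₗ[ℝ] V) := fun q v => by
    have hqa : c (q • c.symm a) = a := by rw [hca, hw]
    obtain ⟨A, hA⟩ : DifferentiableAt ℝ (fun y => c (q • c.symm y)) a :=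
      ((hτ q).contDiffAt hsa).differentiableAt (by simp)
    have h1 : HasFDerivAt (fun y => g (c (q • c.symm y))) (T ∘L A) a :=
      HasFDerivAt.comp a (g := g) (by rw [hqa]; exact hT) hA
    have h2 : HasFDerivAt (fun y => g (c (q • c.symm y)))
        (((σ q : V ≃L[ℝ] V) : V →L[ℝ] V) ∘L T) a :=
      (((σ q : V ≃L[ℝ] V) : V →L[ℝ] V).hasFDerivAt.comp a hT).congr_of_eventuallyEq
        (Filter.eventually_of_mem hsa (hgσ q))
    exact ⟨A v, DFunLike.congr_fun (h1.unique h2) v⟩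
  obtain ⟨P, hPσ, hPT⟩ := exists_continuousLinearMap_norm_eq hTinj σ hσT
  have hga : g a = 0 := by
    ext1 q
    simp [g, hca, hw, a]
  refine ⟨fun x => P (g (c x)), ?_, ?_, ?_⟩
  · exact (isLocalDiffeomorphAt_chartAt (I := 𝓡 n) (k := ∞) w).comp _ _ (g := P ∘ g)
      ((P.contDiff.comp_contDiffOn hg).isLocalDiffeomorphAt hsa
        (by rwa [(P.hasFDerivAt.comp a hT).fderiv]))
  · change P (g a) = 0
    rw [hga, map_zero]
  · filter_upwards [hDo.mem_nhds hwD, c.open_source.mem_nhds hwc] with x hxD hx q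
    have hxs : c x ∈ s := ⟨c.map_source hx, by rwa [Set.mem_preimage, c.left_inv hx]⟩
    have := hgσ q (c x) hxs
    rw [c.left_inv hx] at this
    rw [this, hPσ]

/-- A fixed point of a smooth action of a finite group has arbitrarily small invariant open
neighbourhoods which are diffeomorphic to Euclidean space: the preimages of small balls under
coordinates with invariant norm. -/
theorem exists_partialDiffeomorph_invariant
    (hF : ∀ q : F, ContMDiff (𝓡 n) (𝓡 n) ∞ fun x : W => q • x) {w : W} (hw : ∀ q : F, q • w = w)
    {N : Set W} (hN : N ∈ nhds w) :
    ∃ Θ : PartialDiffeomorph (𝓡 n) (𝓡 n) (EuclideanSpace ℝ (Fin n)) W ∞,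
      Θ.source = Set.univ ∧ w ∈ Θ.target ∧ Θ.target ⊆ N ∧
      ∀ (q : F), ∀ x ∈ Θ.target, q • x ∈ Θ.target := by
  obtain ⟨h, ⟨Φ, hwΦ, hΦ⟩, hhw, hinv⟩ := exists_isLocalDiffeomorphAt_norm_smul_eq hF hw
  obtain ⟨O, hO, hOo, hwO⟩ :=
    eventually_nhds_iff.1 (hinv.and (Filter.inter_mem hN (Φ.open_source.mem_nhds hwΦ)))
  -- the largest invariant subset of `O`
  let O' : Set W := ⋂ q : F, (fun x => q • x) ⁻¹' O
  have hO'o : IsOpen O' := isOpen_iInter_of_finite fun q => hOo.preimage (hF q).continuous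
  have hwO' : w ∈ O' := Set.mem_iInter.2 fun q => by simpa [hw q] using hwO
  have hO'O : O' ⊆ O := fun x hx => by simpa using Set.mem_iInter.1 hx 1
  have hO'inv : ∀ (q : F), ∀ x ∈ O', q • x ∈ O' := fun q x hx => Set.mem_iInter.2 fun q' => by
    simpa [smul_smul] using Set.mem_iInter.1 hx (q' * q)
  let e := Φ.toOpenPartialHomeomorph.restrOpen O' hO'o
  let Φ' : PartialDiffeomorph (𝓡 n) (𝓡 n) W (EuclideanSpace ℝ (Fin n)) ∞ :=
    ⟨e.toPartialEquiv, e.open_source, e.open_target,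
      Φ.contMDiffOn_toFun.mono fun _ hx => hx.1, Φ.contMDiffOn_invFun.mono fun _ hx => hx.1⟩
  have hsrc : ∀ x, x ∈ Φ'.source ↔ x ∈ O' := fun x =>
    ⟨fun hx => hx.2, fun hx => ⟨(hO x (hO'O hx)).2.2, hx⟩⟩
  have hΦ' : ∀ x ∈ O', Φ' x = h x := fun x hx => (hΦ (hO x (hO'O hx)).2.2).symm
  have h0 : (0 : EuclideanSpace ℝ (Fin n)) ∈ Φ'.target := by
    rw [← hhw, ← hΦ' w hwO']
    exact Φ'.map_source ((hsrc w).2 hwO')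
  obtain ⟨r, hr, hball⟩ := Metric.isOpen_iff.1 Φ'.open_target 0 h0
  let β := OpenPartialHomeomorph.univBall (0 : EuclideanSpace ℝ (Fin n)) r
  have hβs : β.source = Set.univ := OpenPartialHomeomorph.univBall_source _ _
  have hβt : β.target = Metric.ball 0 r := OpenPartialHomeomorph.univBall_target _ hr
  let B : PartialDiffeomorph (𝓡 n) (𝓡 n) (EuclideanSpace ℝ (Fin n))
      (EuclideanSpace ℝ (Fin n)) ∞ :=
    ⟨β.toPartialEquiv, β.open_source, β.open_target,
      (contMDiff_iff_contDiff.2 OpenPartialHomeomorph.contDiff_univBall).contMDiffOn,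
      contMDiffOn_iff_contDiffOn.2 (hβt ▸ OpenPartialHomeomorph.contDiffOn_univBall_symm)⟩
  have htarget : ∀ x, x ∈ (B.trans Φ'.symm).target ↔ x ∈ O' ∧ ‖h x‖ < r := fun x => by
    have : x ∈ (B.trans Φ'.symm).target ↔ x ∈ Φ'.source ∧ Φ' x ∈ β.target := Iff.rfl
    rw [this, hβt, mem_ball_zero_iff, hsrc]
    exact and_congr_right fun hx => by rw [hΦ' x hx]
  refine ⟨B.trans Φ'.symm, ?_, ?_, fun x hx => ?_, fun q x hx => ?_⟩
  · refine Set.eq_univ_of_forall fun v => ?_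
    have hv : v ∈ β.source := hβs ▸ Set.mem_univ v
    exact ⟨hv, hball (hβt ▸ β.map_source hv)⟩
  · rw [htarget]
    exact ⟨hwO', by simpa [hhw] using hr⟩
  · exact (hO x (hO'O ((htarget x).1 hx).1)).2.1
  · rw [htarget] at hx ⊢
    exact ⟨hO'inv q x hx.1, by rw [(hO x (hO'O hx.1)).1 q]; exact hx.2⟩

end Slice

/-! ### Coverings by finite quotients -/

/-- A surjective local homeomorphism with Hausdorff source is a regular covering of finite degree
if its fibers are the simply transitive orbits of a finite family of homeomorphisms.  The map is
closed, because the saturation of a closed set is a finite union of closed sets. -/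
theorem IsLocalHomeomorph.isRegularCoveringOfFiniteDegree {E X ι : Type*} [TopologicalSpace E]
    [TopologicalSpace X] [T2Space E] [Finite ι] [Nonempty ι] {f : E → X} (hf : IsLocalHomeomorph f)
    (hsurj : Function.Surjective f) (φ : ι → E ≃ₜ E)
    (hφ : ∀ e e', f e = f e' ↔ ∃ i, φ i e = e')
    (hinj : ∀ e, Function.Injective fun i => φ i e) :
    IsRegularCoveringOfFiniteDegree f := by
  have hfib : ∀ e, f ⁻¹' {f e} = Set.range fun i => φ i e := fun e => by
    ext e'
    rw [Set.mem_preimage, Set.mem_singleton_iff, eq_comm, hφ]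
    rfl
  have hclosed : IsClosedMap f := fun C hC => by
    have hsat : f ⁻¹' (f '' C) = ⋃ i, φ i '' C := by
      ext e
      simp only [Set.mem_preimage, Set.mem_image, Set.mem_iUnion, hφ]
      exact ⟨fun ⟨x, hx, i, hi⟩ => ⟨i, x, hx, hi⟩, fun ⟨i, x, hx, hi⟩ => ⟨x, hx, i, hi⟩⟩
    rw [← (hf.isOpenMap.isQuotientMap hf.continuous hsurj).isClosed_preimage, hsat]
    exact isClosed_iUnion_of_finite fun i => (φ i).isClosedMap C hC
  refine ⟨?_, ⟨Nat.card ι, Nat.card_pos, fun x => ?_⟩, fun e e' h => ?_⟩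
  · rw [isCoveringMap_iff_isCoveringMapOn_univ]
    refine hclosed.isCoveringMapOn_of_isLocalHomeomorphOn (fun x _ => ?_) fun e _ => hf e
    obtain ⟨e, rfl⟩ := hsurj x
    rw [hfib]
    exact Set.finite_range _
  · obtain ⟨e, rfl⟩ := hsurj x
    rw [hfib]
    exact Nat.card_range_of_injective (hinj e)
  · obtain ⟨i, hi⟩ := (hφ e e').1 h
    exact ⟨φ i, fun z => ((hφ z _).2 ⟨i, rfl⟩).symm, hi⟩

/-! ### The intermediate quotient by `Γ` -/

namespace InjectiveSeifertFibering

section Topology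

variable {G W : Type*} [Group G] [TopologicalSpace G] [IsTopologicalGroup G] [TopologicalSpace W]
  (S : InjectiveSeifertFibering G W)

/-- The quotient map `G × W → G / Γ × W` by the action of `Γ`. -/
def fiberProj : G × W → S.TypicalFiber × W :=
  Prod.map (Quotient.mk (MulAction.orbitRel S.toSetup.ΓG G)) id

theorem isOpenQuotientMap_fiberProj : IsOpenQuotientMap S.fiberProj :=
  IsOpenQuotientMap.prodMap
    ⟨Quotient.mk_surjective, continuous_quotient_mk', isOpenMap_quotient_mk'_mul⟩ .id

theorem fiberProj_eq_iff {x y : G × W} :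
    S.fiberProj x = S.fiberProj y ↔ ∃ γ ∈ S.toSetup.Γ, γ • y = x := by
  constructor
  · intro h
    obtain ⟨a, ha⟩ := (MulAction.orbitRel_apply.1 (Quotient.exact (congrArg Prod.fst h)) :)
    exact ⟨⟨Seifert.ell G W a, a.2.1⟩, Subgroup.mem_subgroupOf.2 a.2,
      Prod.ext ha (congrArg Prod.snd h).symm⟩
  · rintro ⟨γ, hγ, rfl⟩
    obtain ⟨a, ha⟩ := (Subgroup.mem_subgroupOf.1 hγ).2
    have ha' : a ∈ S.toSetup.ΓG := Subgroup.mem_comap.2 (ha ▸ Subgroup.mem_subgroupOf.1 hγ)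
    have hy : γ • y = (a * y.1, y.2) := (DFunLike.congr_fun ha y).symm
    rw [hy]
    exact Prod.ext (Quotient.sound (MulAction.orbitRel_apply.2 ⟨⟨a, ha'⟩, rfl⟩)) rfl

theorem fiberProj_smul_congr (f : S.toSetup.π) {x y : G × W} (h : S.fiberProj x = S.fiberProj y) :
    S.fiberProj (f • x) = S.fiberProj (f • y) := by
  obtain ⟨γ, hγ, rfl⟩ := S.fiberProj_eq_iff.1 h
  refine S.fiberProj_eq_iff.2 ⟨f * γ * f⁻¹, S.toSetup.normal.conj_mem γ hγ f, ?_⟩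
  rw [mul_smul, inv_smul_smul, mul_smul]

/-- The action of `π` on `G / Γ × W` induced by its action on `G × W`.  It is well
defined because `Γ` is normal in `π`. -/
instance actionFiberProd : MulAction S.toSetup.π (S.TypicalFiber × W) where
  smul f z := (Quotient.map' (s₁ := MulAction.orbitRel S.toSetup.ΓG G)
    (s₂ := MulAction.orbitRel S.toSetup.ΓG G) (fun g => (f • (g, z.2)).1) (fun g g' h =>
      Quotient.exact (congrArg Prod.fst (S.fiberProj_smul_congr f (x := (g, z.2)) (y := (g', z.2))
        (Prod.ext (Quotient.sound h) rfl)))) z.1, f • z.2)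
  one_smul z := by
    obtain ⟨x, rfl⟩ := S.isOpenQuotientMap_fiberProj.surjective z
    rfl
  mul_smul f f' z := by
    obtain ⟨x, rfl⟩ := S.isOpenQuotientMap_fiberProj.surjective z
    refine Prod.ext ?_ (mul_smul f f' x.2)
    change Quotient.mk _ (f • f' • x).1 = Quotient.mk _ (f • ((f' • x).1, f' • x.2)).1
    rw [S.toSetup.smul_snd f' x]

theorem smul_fiberProj (f : S.toSetup.π) (x : G × W) :
    f • S.fiberProj x = S.fiberProj (f • x) :=
  Prod.ext rfl (S.toSetup.smul_snd f x)

theorem snd_smul (f : S.toSetup.π) (z : S.TypicalFiber × W) :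
    (f • z).2 = (f : S.toSetup.Q) • z.2 := rfl

instance : ContinuousConstSMul S.toSetup.π (S.TypicalFiber × W) :=
  ⟨fun f => S.isOpenQuotientMap_fiberProj.continuous_comp_iff.1 <| by
    change Continuous fun x => f • S.fiberProj x
    simp only [smul_fiberProj]
    exact S.isOpenQuotientMap_fiberProj.continuous.comp (continuous_const_smul f)⟩

instance : ContinuousConstSMul S.toSetup.Q W := ⟨fun q => by
  obtain ⟨f, rfl⟩ := QuotientGroup.mk_surjective q
  exact continuous_snd.comp (f.1.continuous.comp (Continuous.prodMk_right 1))⟩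

/-- Two elements of `π` agree at a point of `G / Γ × W` exactly if they agree modulo `Γ`, because
`π` acts freely on `G × W`. -/
theorem smul_eq_smul_iff {f f' : S.toSetup.π} {z : S.TypicalFiber × W} :
    f • z = f' • z ↔ (f : S.toSetup.Q) = f' := by
  obtain ⟨x, rfl⟩ := S.isOpenQuotientMap_fiberProj.surjective z
  rw [smul_fiberProj, smul_fiberProj, fiberProj_eq_iff, eq_comm (a := (f : S.toSetup.Q)),
    QuotientGroup.eq]
  constructor
  · rintro ⟨γ, hγ, h⟩
    rw [smul_smul] at h
    rw [← IsCancelSMul.right_cancel _ _ _ h]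
    simpa [mul_assoc] using S.toSetup.normal.conj_mem γ hγ f'⁻¹
  · intro h
    refine ⟨f * f'⁻¹, ?_, by rw [smul_smul, inv_mul_cancel_right]⟩
    simpa [mul_assoc] using S.toSetup.normal.conj_mem _ h f'

/-- The map `G / Γ × W → M` induced by the quotient map `G × W → M`. -/
def totalProj (z : S.TypicalFiber × W) : S.TotalSpace :=
  Quotient.liftOn z.1 (fun g => Quotient.mk (MulAction.orbitRel S.toSetup.π (G × W)) (g, z.2))
    fun g g' h => by
      obtain ⟨γ, -, hγ⟩ := S.fiberProj_eq_iff.1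
        (Prod.ext (Quotient.sound h) rfl : S.fiberProj (g, z.2) = S.fiberProj (g', z.2))
      exact Quotient.sound (MulAction.orbitRel_apply.2 ⟨γ, hγ⟩)

theorem totalProj_fiberProj (x : G × W) :
    S.totalProj (S.fiberProj x) = Quotient.mk (MulAction.orbitRel S.toSetup.π (G × W)) x := rfl

theorem continuous_totalProj : Continuous S.totalProj :=
  S.isOpenQuotientMap_fiberProj.continuous_comp_iff.1 continuous_quotient_mk'

theorem surjective_totalProj : Function.Surjective S.totalProj := fun y => by
  obtain ⟨x, rfl⟩ := Quotient.mk_surjective y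
  exact ⟨S.fiberProj x, rfl⟩

theorem totalProj_eq_iff {z z' : S.TypicalFiber × W} :
    S.totalProj z = S.totalProj z' ↔ ∃ f : S.toSetup.π, f • z = z' := by
  obtain ⟨x, rfl⟩ := S.isOpenQuotientMap_fiberProj.surjective z
  obtain ⟨x', rfl⟩ := S.isOpenQuotientMap_fiberProj.surjective z'
  rw [totalProj_fiberProj, totalProj_fiberProj]
  constructor
  · intro h
    obtain ⟨f, hf⟩ := (MulAction.orbitRel_apply.1 (Quotient.exact h.symm) :)
    exact ⟨f, by rw [smul_fiberProj]; exact congrArg S.fiberProj hf⟩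
  · rintro ⟨f, hf⟩
    rw [smul_fiberProj, fiberProj_eq_iff] at hf
    obtain ⟨γ, -, hγ⟩ := hf
    refine Quotient.sound (MulAction.orbitRel_apply.2 ⟨f⁻¹ * γ, ?_⟩)
    change (f⁻¹ * γ) • x' = x
    rw [mul_smul, hγ, inv_smul_smul]

theorem p_totalProj (z : S.TypicalFiber × W) :
    S.p (S.totalProj z) = Quotient.mk (MulAction.orbitRel S.toSetup.Q W) z.2 := by
  obtain ⟨x, rfl⟩ := S.isOpenQuotientMap_fiberProj.surjective z
  rfl

/-! ### The covering over an invariant ball -/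

section Slice

variable {S} {E : Type*} [TopologicalSpace E] (e : OpenPartialHomeomorph E W)

/-- An element of `π` which preserves the image of a parametrization `e` of an open subset of `W`
acts on `G / Γ × E` by a homeomorphism. -/
def deckHomeo (he : e.source = Set.univ) (f : S.toSetup.π)
    (hf : ∀ w ∈ e.target, f • w ∈ e.target) (hf' : ∀ w ∈ e.target, f⁻¹ • w ∈ e.target) :
    S.TypicalFiber × E ≃ₜ S.TypicalFiber × E := by
  have hmem : ∀ v, e v ∈ e.target := fun v => e.map_source (he ▸ Set.mem_univ v)
  have hcont : ∀ f : S.toSetup.π, (∀ w ∈ e.target, f • w ∈ e.target) →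
      Continuous fun y : S.TypicalFiber × E => Prod.map id e.symm (f • Prod.map id e y) := by
    intro f hf
    have he' : Continuous e := continuousOn_univ.1 (he ▸ e.continuousOn)
    have h : Continuous fun y : S.TypicalFiber × E => f • Prod.map id e y :=
      (continuous_id.prodMap he').const_smul f
    have h₂ : Continuous fun y : S.TypicalFiber × E => (f • Prod.map id e y).2 :=
      continuous_snd.comp h
    exact (continuous_fst.comp h).prodMk
      (e.continuousOn_symm.comp_continuous h₂ fun y => hf _ (hmem _))
  have hinv : ∀ f : S.toSetup.π, (∀ w ∈ e.target, f • w ∈ e.target) →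
      ∀ y : S.TypicalFiber × E, Prod.map id e.symm
        (f⁻¹ • Prod.map id e (Prod.map id e.symm (f • Prod.map id e y))) = y := by
    intro f hf y
    have h : Prod.map id e (Prod.map id e.symm (f • Prod.map id e y)) = f • Prod.map id e y :=
      Prod.ext rfl (e.right_inv (hf _ (hmem _)))
    rw [h, inv_smul_smul]
    exact Prod.ext rfl (e.left_inv (he ▸ Set.mem_univ y.2))
  exact
    { toFun := fun y => Prod.map id e.symm (f • Prod.map id e y)
      invFun := fun y => Prod.map id e.symm (f⁻¹ • Prod.map id e y)
      left_inv := hinv f hf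
      right_inv := fun y => by simpa using hinv f⁻¹ hf' y
      continuous_toFun := hcont f hf
      continuous_invFun := hcont f⁻¹ hf' }

theorem map_deckHomeo (he : e.source = Set.univ) (f : S.toSetup.π)
    (hf : ∀ w ∈ e.target, f • w ∈ e.target) (hf' : ∀ w ∈ e.target, f⁻¹ • w ∈ e.target)
    (y : S.TypicalFiber × E) :
    Prod.map id e (deckHomeo e he f hf hf' y) = f • Prod.map id e y :=
  Prod.ext rfl (e.right_inv (hf _ (e.map_source (he ▸ Set.mem_univ y.2))))

/-- The open subset of `B` covered by the image of `e`. -/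
def baseOpen : TopologicalSpace.Opens S.Base :=
  ⟨Quotient.mk (MulAction.orbitRel S.toSetup.Q W) '' e.target,
    isOpenMap_quotient_mk'_mul _ e.open_target⟩

/-- The map `G / Γ × E → p⁻¹(V)` induced by `G × W → M`, where `e` parametrizes an open subset of
`W` with image `V` in `B`. -/
def localCovering (he : e.source = Set.univ) (y : S.TypicalFiber × E) :
    ((baseOpen (S := S) e).comap S.p : TopologicalSpace.Opens S.TotalSpace) :=
  ⟨S.totalProj (Prod.map id e y), by
    change S.p (S.totalProj (Prod.map id e y)) ∈ Quotient.mk _ '' e.target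
    rw [p_totalProj]
    exact ⟨e y.2, e.map_source (he ▸ Set.mem_univ y.2), rfl⟩⟩

theorem continuous_localCovering (he : e.source = Set.univ) :
    Continuous (localCovering (S := S) e he) :=
  (S.continuous_totalProj.comp
    (continuous_id.prodMap (continuousOn_univ.1 (he ▸ e.continuousOn)))).subtype_mk _

theorem surjective_localCovering (he : e.source = Set.univ) :
    Function.Surjective (localCovering (S := S) e he) := by
  rintro ⟨y, hy⟩
  obtain ⟨z, rfl⟩ := S.surjective_totalProj y
  change S.p (S.totalProj z) ∈ Quotient.mk _ '' e.target at hy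
  rw [p_totalProj] at hy
  obtain ⟨u, hu, huz⟩ := hy
  obtain ⟨q, hq⟩ := (MulAction.orbitRel_apply.1 (Quotient.exact huz) :)
  obtain ⟨f, rfl⟩ := QuotientGroup.mk_surjective q
  have hfu : (f • z).2 = u := hq
  refine ⟨((f • z).1, e.symm u), Subtype.ext (S.totalProj_eq_iff.2 ⟨f⁻¹, ?_⟩)⟩
  rw [inv_smul_eq_iff]
  exact Prod.ext rfl ((e.right_inv hu).trans hfu.symm)

/-- If the image of `e` is invariant under the isotropy group of `w` and disjoint from its other
translates, the isotropy group acts simply transitively on the fibers of `localCovering`. -/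
theorem isRegularCoveringOfFiniteDegree_localCovering [T2Space E] [T2Space S.TypicalFiber]
    (he : e.source = Set.univ) (w : W) [Finite (MulAction.stabilizer S.toSetup.Q w)]
    (hinv : ∀ q ∈ MulAction.stabilizer S.toSetup.Q w, ∀ x ∈ e.target, q • x ∈ e.target)
    (hdisj : ∀ q : S.toSetup.Q, ∀ x ∈ e.target, q • x ∈ e.target →
      q ∈ MulAction.stabilizer S.toSetup.Q w)
    (hloc : IsLocalHomeomorph (localCovering (S := S) e he)) :
    IsRegularCoveringOfFiniteDegree (localCovering (S := S) e he) := by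
  have hout : ∀ q : S.toSetup.Q, ((q.out : S.toSetup.π) : S.toSetup.Q) = q := fun q => q.out_eq'
  have hj : Function.Injective (Prod.map id e : S.TypicalFiber × E → S.TypicalFiber × W) :=
    Function.injective_id.prodMap fun v v' h =>
      e.injOn (he ▸ Set.mem_univ v) (he ▸ Set.mem_univ v') h
  let φ : MulAction.stabilizer S.toSetup.Q w → S.TypicalFiber × E ≃ₜ S.TypicalFiber × E :=
    fun q => deckHomeo e he (q : S.toSetup.Q).out
      (fun x hx => by
        change (((q : S.toSetup.Q).out : S.toSetup.π) : S.toSetup.Q) • x ∈ e.target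
        rw [hout]
        exact hinv q q.2 x hx)
      (fun x hx => by
        change ((((q : S.toSetup.Q).out)⁻¹ : S.toSetup.π) : S.toSetup.Q) • x ∈ e.target
        rw [QuotientGroup.mk_inv, hout]
        exact hinv _ (inv_mem q.2) x hx)
  have hφ : ∀ q y, Prod.map id e (φ q y) = (q : S.toSetup.Q).out • Prod.map id e y :=
    fun q y => map_deckHomeo e he _ _ _ y
  refine hloc.isRegularCoveringOfFiniteDegree (surjective_localCovering e he) φ
    (fun y y' => ?_) fun y q q' h => ?_
  · rw [Subtype.ext_iff]
    change S.totalProj _ = S.totalProj _ ↔ _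
    rw [totalProj_eq_iff]
    constructor
    · rintro ⟨f, hf⟩
      have hfw : (f : S.toSetup.Q) ∈ MulAction.stabilizer S.toSetup.Q w := by
        refine hdisj f (e y.2) (e.map_source (he ▸ Set.mem_univ _)) ?_
        have : (f : S.toSetup.Q) • e y.2 = e y'.2 := congrArg Prod.snd hf
        rw [this]
        exact e.map_source (he ▸ Set.mem_univ _)
      refine ⟨⟨f, hfw⟩, hj ?_⟩
      rw [hφ, ← hf, smul_eq_smul_iff]
      exact hout _
    · rintro ⟨q, rfl⟩
      exact ⟨_, (hφ q y).symm⟩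
  · have h' := congrArg (Prod.map id e) h
    simp only [hφ] at h'
    rw [smul_eq_smul_iff, hout, hout] at h'
    exact Subtype.ext h'

end Slice

end Topology

section Smooth

theorem IsSmooth.contMDiff_smul {m n : ℕ} {G W : Type*} [Group G] [TopologicalSpace G]
    [IsTopologicalGroup G] [TopologicalSpace W] [ChartedSpace (EuclideanSpace ℝ (Fin m)) G]
    [ChartedSpace (EuclideanSpace ℝ (Fin n)) W] {S : InjectiveSeifertFibering G W}
    (hS : S.IsSmooth m n) (q : S.toSetup.Q) :
    ContMDiff (𝓡 n) (𝓡 n) ∞ fun w : W => q • w := by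
  obtain ⟨f, rfl⟩ := QuotientGroup.mk_surjective q
  exact contMDiff_snd.comp ((hS f f.2).comp (contMDiff_const.prodMk contMDiff_id))

variable {m n : ℕ} {G W : Type*}
    [Group G] [TopologicalSpace G] [IsTopologicalGroup G] [T2Space G]
    [ChartedSpace (EuclideanSpace ℝ (Fin m)) G] [LieGroup (𝓡 m) ∞ G]
    [TopologicalSpace W] [T2Space W]
    [ChartedSpace (EuclideanSpace ℝ (Fin n)) W] [IsManifold (𝓡 n) ∞ W]
    {S : InjectiveSeifertFibering G W}

theorem isLocalDiffeomorph_localCovering (hS : S.IsSmooth m n)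
    (Θ : PartialDiffeomorph (𝓡 n) (𝓡 n) (EuclideanSpace ℝ (Fin n)) W ∞)
    (hΘ : Θ.source = Set.univ) :
    IsLocalDiffeomorph ((𝓡 m).prod (𝓡 n)) ((𝓡 m).prod (𝓡 n)) ∞
      (localCovering (S := S) Θ.toOpenPartialHomeomorph hΘ) := by
  have : LocallyCompactSpace G := ChartedSpace.locallyCompactSpace (EuclideanSpace ℝ (Fin m)) G
  have : LocallyCompactSpace W := ChartedSpace.locallyCompactSpace (EuclideanSpace ℝ (Fin n)) W
  have : IsManifold (𝓡 m) ∞ G := ContMDiffMul.toIsManifold (I := 𝓡 m) (n := ∞) (G := G)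
  have := S.isManifold_totalSpace hS
  rintro ⟨y, v⟩
  obtain ⟨g, rfl⟩ := Quotient.mk_surjective y
  have hG : IsLocalDiffeomorph (𝓡 m) (𝓡 m) ∞
      (Quotient.mk (MulAction.orbitRel S.toSetup.ΓG G) : G → S.TypicalFiber) :=
    isLocalDiffeomorph_orbitQuotient_mk fun d => contMDiff_mul_left (a := (d : G))
  have hM : IsLocalDiffeomorph ((𝓡 m).prod (𝓡 n)) ((𝓡 m).prod (𝓡 n)) ∞
      (Quotient.mk (MulAction.orbitRel S.toSetup.π (G × W)) : G × W → S.TotalSpace) :=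
    isLocalDiffeomorph_orbitQuotient_mk fun f => hS f f.2
  have hidG : IsLocalDiffeomorphAt (𝓡 m) (𝓡 m) ∞ (id : G → G) g :=
    (Diffeomorph.refl (𝓡 m) G ∞).isLocalDiffeomorph g
  have hidE : IsLocalDiffeomorphAt (𝓡 n) (𝓡 n) ∞
      (id : EuclideanSpace ℝ (Fin n) → EuclideanSpace ℝ (Fin n)) v :=
    (Diffeomorph.refl (𝓡 n) (EuclideanSpace ℝ (Fin n)) ∞).isLocalDiffeomorph v
  have hΘv : IsLocalDiffeomorphAt (𝓡 n) (𝓡 n) ∞ Θ v :=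
    Θ.isLocalDiffeomorphAt _ _ _ (hΘ ▸ Set.mem_univ v)
  have hs : IsLocalDiffeomorphAt ((𝓡 m).prod (𝓡 n)) ((𝓡 m).prod (𝓡 n)) ∞
      (Prod.map (Quotient.mk (MulAction.orbitRel S.toSetup.ΓG G)) id :
        G × EuclideanSpace ℝ (Fin n) → S.TypicalFiber × EuclideanSpace ℝ (Fin n)) (g, v) :=
    (hG g).prodMap hidE
  -- lifted to `G × ℝⁿ` and followed by the inclusion into `M`, the map is `id × Θ` followed by the
  -- projection `G × W → M`
  refine hs.of_comp (IsLocalDiffeomorphAt.of_comp_left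
    (TopologicalSpace.Opens.isLocalDiffeomorph_subtypeVal _ _)
    ((hidG.prodMap hΘv).comp _ _ (hM _)) ?_)
  exact ((continuous_localCovering _ hΘ).comp
    (continuous_quotient_mk'.prodMap continuous_id)).continuousAt

end Smooth

end InjectiveSeifertFibering

theorem mainTheorem6 {m n : ℕ} {G W : Type*}
    [Group G] [TopologicalSpace G] [IsTopologicalGroup G] [T2Space G] [SecondCountableTopology G]
    [ConnectedSpace G] [ChartedSpace (EuclideanSpace ℝ (Fin m)) G] [LieGroup (𝓡 m) ∞ G]
    [TopologicalSpace W] [T2Space W] [SecondCountableTopology W] [ContractibleSpace W]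
    [ChartedSpace (EuclideanSpace ℝ (Fin n)) W] [IsManifold (𝓡 n) ∞ W]
    (S : InjectiveSeifertFibering G W) (hS : S.IsSmooth m n) (b : S.Base) :
    ∃ V : TopologicalSpace.Opens S.Base, b ∈ V ∧
      ∃ ψ : S.TypicalFiber × EuclideanSpace ℝ (Fin n) → (V.comap S.p : TopologicalSpace.Opens _),
        IsRegularCoveringOfFiniteDegree ψ ∧
        IsLocalDiffeomorph ((𝓡 m).prod (𝓡 n)) ((𝓡 m).prod (𝓡 n)) ∞ ψ := by
  have : LocallyCompactSpace G := ChartedSpace.locallyCompactSpace (EuclideanSpace ℝ (Fin m)) G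
  have : LocallyCompactSpace W := ChartedSpace.locallyCompactSpace (EuclideanSpace ℝ (Fin n)) W
  have := S.proper_Q
  obtain ⟨w, rfl⟩ := Quotient.mk_surjective b
  -- the isotropy group of `w` is finite, and a neighbourhood of `w` misses its other translates
  have : Finite (MulAction.stabilizer S.toSetup.Q w) := by
    refine ((ProperlyDiscontinuousSMul.finite_disjoint_inter_image (Γ := S.toSetup.Q)
      (isCompact_singleton (x := w)) (isCompact_singleton (x := w))).subset
        fun q hq => ?_).to_subtype
    exact ⟨w, ⟨w, rfl, hq⟩, rfl⟩
  obtain ⟨N, hN, hNq⟩ :=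
    ProperlyDiscontinuousSMul.exists_nhds_image_smul_eq_self S.toSetup.Q w
  obtain ⟨Θ, hΘ, hwΘ, hΘN, hinv⟩ := exists_partialDiffeomorph_invariant
    (F := MulAction.stabilizer S.toSetup.Q w) (fun q => hS.contMDiff_smul q.1) (fun q => q.2) hN
  have hloc := InjectiveSeifertFibering.isLocalDiffeomorph_localCovering hS Θ hΘ
  refine ⟨InjectiveSeifertFibering.baseOpen Θ.toOpenPartialHomeomorph, ⟨w, hwΘ, rfl⟩,
    InjectiveSeifertFibering.localCovering Θ.toOpenPartialHomeomorph hΘ, ?_, hloc⟩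
  exact InjectiveSeifertFibering.isRegularCoveringOfFiniteDegree_localCovering _ hΘ w
    (fun q hq => hinv ⟨q, hq⟩)
    (fun q x hx hqx => hNq q ⟨q • x, ⟨x, hΘN hx, rfl⟩, hΘN hqx⟩)
    hloc.isLocalHomeomorph
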